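/- Let $X$ be a Polish space and let $(X,\mu)$ be a measure-interval, that is, a finite complete measure space for which there is a measure-preserving transformation onto $[0,\mu(X)]$ with Lebesgue measure (a bijection off null sets such that it and its inverse preserve measurability and measure). Let $Y\subset\mathbb{R}^n$ be Lebesgue measurable with $\lambda_n(Y)=\mu(X)$ and $\int_Y|y|^2\,d\lambda_n<\infty$, where $\lambda_n$ is $n$-dimensional Lebesgue measure, and let $u\in L^2(X,\mu,\mathbb{R}^n)$. Let $\Pi(\mu,\lambda_n)$ be the set of measure-preserving plans, i.e. of measures $\pi$ on $X\times Y$ with $\pi(A\times Y)=\mu(A)$ and $\pi(X\times B)=\lambda_n(B)$ for all measurable $A\subset X$, $B\subset Y$. Put $c(x,y)=|u(x)-y|^2/2$ on $X\times Y$ and $I(\gamma)=\int_{X\times Y}c\,d\gamma$ for $\gamma\in\Pi(\mu,\lambda_n)$. For $\psi:\mathbb{R}^n\to\mathbb{R}\cup\{-\infty,\infty\}$ write $\partial\psi(y)=\{z:\psi(w)\ge\psi(y)+z\cdot(w-y)\ \text{for all } w\in\mathbb{R}^n\}$, and call $\psi$ proper if it is not identically $\infty$ and nowhere $-\infty$.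 (i) Suppose that $\pi\in\Pi(\mu,\lambda_n)$ and that $u(x)\in\partial\psi(y)$ for $\pi$-a.e. $(x,y)$, where $\psi:\mathbb{R}^n\to\mathbb{R}\cup\{-\infty,\infty\}$ is proper, convex and lower semicontinuous. Then $\pi$ attains $\inf\{I(\gamma):\gamma\in\Pi(\mu,\lambda_n)\}$. (ii) Suppose that $c$ is lower semicontinuous on $X\times Y$ and that $\pi\in\Pi(\mu,\lambda_n)$ minimises $I$ over $\Pi(\mu,\lambda_n)$. Then there is a proper, convex, lower semicontinuous $\psi:\mathbb{R}^n\to\mathbb{R}\cup\{-\infty,\infty\}$ such that $u(x)\in\partial\psi(y)$ for $\pi$-a.e. $(x,y)$. -/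

import Mathlib

open MeasureTheory Set
open scoped ENNReal

namespace PolarInclusion

section MeasureInterval

variable {α β : Type*} [MeasurableSpace α] [MeasurableSpace β]

/-- `t` is a measure-preserving transformation from `(α, μ)` to `(β, ν)`: outside null sets `L`
and `M` it is a bijection, and both the bijection and its inverse preserve measurability and
measure. Measurability refers to the completed σ-algebras (so to the Lebesgue sets when `ν` is
Lebesgue measure, and to the given measurable sets when `μ` is complete). -/
def IsMeasurePreservingTransformation (μ : Measure α) (ν : Measure β) (t : α → β) : Prop :=
  ∃ (L : Set α) (M : Set β), μ L = 0 ∧ ν M = 0 ∧ BijOn t Lᶜ Mᶜ ∧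
    (∀ B : Set β, B ⊆ Mᶜ → NullMeasurableSet B ν →
      NullMeasurableSet (Lᶜ ∩ t ⁻¹' B) μ ∧ μ (Lᶜ ∩ t ⁻¹' B) = ν B) ∧
    (∀ A : Set α, A ⊆ Lᶜ → NullMeasurableSet A μ →
      NullMeasurableSet (t '' A) ν ∧ ν (t '' A) = μ A)

/-- A finite complete measure space `(α, μ)` is a measure-interval if there is a
measure-preserving transformation from it to `[0, μ(α)]` with Lebesgue measure. -/
structure IsMeasureInterval (μ : Measure α) : Prop where
  isFiniteMeasure : IsFiniteMeasure μ
  isComplete : μ.IsComplete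
  exists_transformation : ∃ t : α → Icc (0 : ℝ) (μ.real univ),
    IsMeasurePreservingTransformation μ (Measure.comap Subtype.val (volume : Measure ℝ)) t

end MeasureInterval

section Transport

variable {X : Type*} {n : ℕ} {Y : Set (EuclideanSpace ℝ (Fin n))}

/-- The set `Π(μ, λₙ)` of measure-preserving plans: the measures on `X × Y` whose marginals are
`μ` on `X` and `n`-dimensional Lebesgue measure on `Y`. -/
def plans [MeasurableSpace X] (μ : Measure X) (Y : Set (EuclideanSpace ℝ (Fin n))) :
    Set (Measure (X × Y)) :=
  {π | (∀ A : Set X, MeasurableSet A → π (A ×ˢ (univ : Set Y)) = μ A) ∧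
    ∀ B : Set Y, MeasurableSet B → π ((univ : Set X) ×ˢ B) = volume (Subtype.val '' B)}

/-- The cost `c(x, y) = |u(x) - y|² / 2` on `X × Y`, with values in `[0, ∞]`. -/
noncomputable def cost (u : X → EuclideanSpace ℝ (Fin n)) (p : X × Y) : ℝ≥0∞ :=
  ENNReal.ofReal (‖u p.1 - (p.2 : EuclideanSpace ℝ (Fin n))‖ ^ 2 / 2)

/-- The total cost `I(γ) = ∫ c dγ`. -/
noncomputable def totalCost [MeasurableSpace X] (u : X → EuclideanSpace ℝ (Fin n))
    (γ : Measure (X × Y)) : ℝ≥0∞ :=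
  ∫⁻ p, cost u p ∂γ

end Transport

section Convex

variable {E : Type*} [NormedAddCommGroup E] [InnerProductSpace ℝ E]

/-- An extended-real-valued function is convex if its epigraph is convex. -/
def IsConvexFun (ψ : E → EReal) : Prop :=
  Convex ℝ {p : E × ℝ | ψ p.1 ≤ (p.2 : EReal)}

/-- An extended-real-valued function is proper if it is not identically `∞` and nowhere takes
the value `-∞`. -/
def IsProperFun (ψ : E → EReal) : Prop :=
  (∃ y, ψ y ≠ ⊤) ∧ ∀ y, ψ y ≠ ⊥

/-- The subdifferential `∂ψ(y)`. -/
def subdifferential (ψ : E → EReal) (y : E) : Set E :=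
  {z | ∀ w : E, ψ y + ((inner ℝ z (w - y) : ℝ) : EReal) ≤ ψ w}

end Convex

end PolarInclusion

/-! Since |z - y|²/2 = |z|²/2 + |y|²/2 - z·y and the marginals fix the integrals of the squares,
minimising the cost means maximising the integral of u(x)·y. Sufficiency is Fenchel–Young duality:
z·y ≤ ψ(y) + ψ*(z), with equality when z ∈ ∂ψ(y), and the right side integrates to the same value
for every plan. Neither ψ nor ψ* need be integrable, so both are normalised at one pair z₀ ∈ ∂ψ(y₀)
to be [0, ∞]-valued (`excess`, `conjExcess`). Necessity: the support of the image of π under (u, id)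
is cyclically monotone, since otherwise mass near finitely many of its points could be re-paired at
lower cost (`sum_lintegral_cost_le_of_isMinOn`). Rockafellar's construction then gives ψ. -/

namespace PolarInclusion

/-! ### Cyclic monotonicity and Rockafellar's theorem -/

section Rockafellar

variable {E : Type*} [NormedAddCommGroup E] [InnerProductSpace ℝ E]

/-- The value at `w` of the affine function obtained by following the chain `c` for `m` steps. -/
noncomputable def chainValue (c : ℕ → E × E) (m : ℕ) (w : E) : ℝ :=
  ∑ i ∈ Finset.range m, inner ℝ (c i).1 ((c (i + 1)).2 - (c i).2) +
    inner ℝ (c m).1 (w - (c m).2)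

/-- A cyclically monotone set of pairs `(z, y)`. -/
def IsCyclicallyMonotone (S : Set (E × E)) : Prop :=
  ∀ (m : ℕ) (q : Fin (m + 1) → E × E), (∀ i, q i ∈ S) →
    ∑ i, inner ℝ (q i).1 (q (finRotate (m + 1) i)).2 ≤ ∑ i, inner ℝ (q i).1 (q i).2

/-- Closing the chain at its starting point turns its value into the cyclic sum for `finRotate`.
This keeps the supremum over chains finite at the base point. -/
theorem IsCyclicallyMonotone.chainValue_le_zero {S : Set (E × E)} (hS : IsCyclicallyMonotone S)
    {c : ℕ → E × E} (hc : ∀ i, c i ∈ S) (m : ℕ) : chainValue c m (c 0).2 ≤ 0 := by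
  have h := hS m (fun i => c i) (fun i => hc i)
  rw [Fin.sum_univ_castSucc, Fin.sum_univ_castSucc] at h
  have h1 : ∀ i : Fin m, finRotate (m + 1) i.castSucc = i.succ := by
    intro i
    rw [finRotate_apply, Fin.coeSucc_eq_succ]
  simp only [h1, finRotate_last, Fin.val_castSucc, Fin.val_succ, Fin.val_last, Fin.val_zero] at h
  rw [Fin.sum_univ_eq_sum_range (fun i => inner ℝ (c i).1 (c (i + 1)).2) m,
    Fin.sum_univ_eq_sum_range (fun i => inner ℝ (c i).1 (c i).2) m] at h
  simp only [chainValue, inner_sub_right, Finset.sum_sub_distrib]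
  linarith

/-- Appending p to a chain ending anywhere is what yields the subgradient inequality at p. -/
theorem chainValue_extend (c : ℕ → E × E) (m : ℕ) (p : E × E) (w : E) :
    chainValue (fun i => if i ≤ m then c i else p) (m + 1) w =
      chainValue c m p.2 + inner ℝ p.1 (w - p.2) := by
  have h : ∑ i ∈ Finset.range m, inner ℝ (if i ≤ m then c i else p).1
        ((if i + 1 ≤ m then c (i + 1) else p).2 - (if i ≤ m then c i else p).2) =
      ∑ i ∈ Finset.range m, inner ℝ (c i).1 ((c (i + 1)).2 - (c i).2) := by
    refine Finset.sum_congr rfl fun i hi => ?_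
    have := Finset.mem_range.1 hi
    rw [if_pos (by omega), if_pos (by omega)]
  simp only [chainValue, Finset.sum_range_succ, h]
  simp

theorem isConvexFun_iSup_affine {ι : Type*} (z : ι → E) (b : ι → ℝ) :
    IsConvexFun fun w : E => ⨆ i, ((inner ℝ (z i) w + b i : ℝ) : EReal) := by
  have : {p : E × ℝ | (⨆ i, ((inner ℝ (z i) p.1 + b i : ℝ) : EReal)) ≤ (p.2 : EReal)} =
      ⋂ i, {p : E × ℝ | inner ℝ (z i) p.1 + b i ≤ p.2} := by
    ext p
    simp only [mem_ofPred_eq, iSup_le_iff, EReal.coe_le_coe_iff, mem_iInter]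
  rw [IsConvexFun, this]
  refine convex_iInter fun i => ?_
  rintro ⟨x, r⟩ hx ⟨y, s⟩ hy a a' ha ha' haa
  simp only [mem_ofPred_eq, Prod.smul_mk, Prod.mk_add_mk, inner_add_right, inner_smul_right,
    smul_eq_mul] at hx hy ⊢
  have h1 := mul_le_mul_of_nonneg_left hx ha
  have h2 := mul_le_mul_of_nonneg_left hy ha'
  have h3 : b i = a * b i + a' * b i := by rw [← add_mul, haa, one_mul]
  linarith

/-- Rockafellar's theorem: a cyclically monotone set is contained in the graph of the
subdifferential of a proper, convex, lower semicontinuous function. -/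
theorem IsCyclicallyMonotone.exists_subdifferential {S : Set (E × E)}
    (hS : IsCyclicallyMonotone S) :
    ∃ ψ : E → EReal, IsProperFun ψ ∧ IsConvexFun ψ ∧ LowerSemicontinuous ψ ∧
      ∀ p ∈ S, p.1 ∈ subdifferential ψ p.2 := by
  rcases S.eq_empty_or_nonempty with rfl | ⟨q, hq⟩
  · refine ⟨fun _ => 0, ⟨⟨0, by simp⟩, by simp⟩, ?_, lowerSemicontinuous_const, by simp⟩
    simpa using isConvexFun_iSup_affine (fun _ : Unit => (0 : E)) (fun _ => 0)
  -- Chains start at the fixed pair q; only the first m + 1 terms of the sequence matter.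
  let ι := {c : ℕ → E × E // c 0 = q ∧ ∀ i, c i ∈ S} × ℕ
  let ψ : E → EReal := fun w => ⨆ i : ι, (chainValue i.1.1 i.2 w : EReal)
  have hle : ∀ (i : ι) w, (chainValue i.1.1 i.2 w : EReal) ≤ ψ w := fun i w =>
    le_iSup (fun i : ι => (chainValue i.1.1 i.2 w : EReal)) i
  refine ⟨ψ, ⟨⟨q.2, ?_⟩, fun y => ?_⟩, ?_, ?_, ?_⟩
  · refine ne_top_of_le_ne_top EReal.zero_ne_top (iSup_le fun i => ?_)
    have h := hS.chainValue_le_zero i.1.2.2 i.2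
    rw [i.1.2.1] at h
    exact_mod_cast h
  · exact ne_bot_of_le_ne_bot (EReal.coe_ne_bot _) (hle (⟨fun _ => q, rfl, fun _ => hq⟩, 0) y)
  · convert isConvexFun_iSup_affine (fun i : ι => (i.1.1 i.2).1)
      (fun i : ι => chainValue i.1.1 i.2 0) using 5
    simp only [chainValue, inner_sub_right, inner_zero_right]
    ring
  · refine lowerSemicontinuous_iSup fun i => Continuous.lowerSemicontinuous ?_
    refine continuous_coe_real_ereal.comp ?_
    unfold chainValue
    fun_prop
  · intro p hp w
    rw [← EReal.le_sub_iff_add_le (Or.inl (EReal.coe_ne_bot _)) (Or.inl (EReal.coe_ne_top _))]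
    refine iSup_le fun i => ?_
    rw [EReal.le_sub_iff_add_le (Or.inl (EReal.coe_ne_bot _)) (Or.inl (EReal.coe_ne_top _)),
      ← EReal.coe_add, ← chainValue_extend]
    refine hle (⟨fun k => if k ≤ i.2 then i.1.1 k else p, ?_, fun k => ?_⟩, i.2 + 1) w
    · simpa using i.1.2.1
    · dsimp only
      split_ifs
      exacts [i.1.2.2 k, hp]

end Rockafellar

/-! ### Marginals of plans and finiteness of the cost -/

section Plans

variable {X : Type*} [MeasurableSpace X] {n : ℕ} {Y : Set (EuclideanSpace ℝ (Fin n))}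
  {μ : Measure X} {γ π : Measure (X × Y)} {u : X → EuclideanSpace ℝ (Fin n)}

theorem map_fst_of_mem_plans (h : γ ∈ plans μ Y) : γ.map Prod.fst = μ := by
  ext A hA
  rw [Measure.map_apply measurable_fst hA, ← h.1 A hA, prod_univ]

theorem map_snd_of_mem_plans (h : γ ∈ plans μ Y) :
    γ.map (fun p => (p.2 : EuclideanSpace ℝ (Fin n))) = volume.restrict Y := by
  ext B hB
  rw [Measure.map_apply (by fun_prop) hB, Measure.restrict_apply hB,
    inter_comm, ← Subtype.image_preimage_coe, ← h.2 _ (measurable_subtype_coe hB), univ_prod]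
  rfl

theorem mem_plans_of_map_eq (h : π ∈ plans μ Y) (h1 : γ.map Prod.fst = π.map Prod.fst)
    (h2 : γ.map Prod.snd = π.map Prod.snd) : γ ∈ plans μ Y := by
  refine ⟨fun A hA => ?_, fun B hB => ?_⟩
  · rw [← h.1 A hA, prod_univ, ← Measure.map_apply measurable_fst hA, h1,
      Measure.map_apply measurable_fst hA]
  · rw [← h.2 B hB, univ_prod, ← Measure.map_apply measurable_snd hB, h2,
      Measure.map_apply measurable_snd hB]

theorem lintegral_fst_of_mem_plans (h : γ ∈ plans μ Y) {f : X → ℝ≥0∞} (hf : Measurable f) :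
    ∫⁻ p, f p.1 ∂γ = ∫⁻ x, f x ∂μ := by
  rw [← map_fst_of_mem_plans h, lintegral_map hf measurable_fst]

theorem lintegral_snd_of_mem_plans (h : γ ∈ plans μ Y) {f : EuclideanSpace ℝ (Fin n) → ℝ≥0∞}
    (hf : Measurable f) : ∫⁻ p, f p.2 ∂γ = ∫⁻ y in Y, f y := by
  rw [← map_snd_of_mem_plans h, lintegral_map hf (by fun_prop)]

theorem measurable_cost (hu : Measurable u) : Measurable (cost u : X × Y → ℝ≥0∞) := by
  unfold cost
  fun_prop

theorem lintegral_norm_sub_sq_lt_top [IsFiniteMeasure μ] (hu2 : MemLp u 2 μ)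
    (z : EuclideanSpace ℝ (Fin n)) :
    ∫⁻ x, ENNReal.ofReal (‖u x - z‖ ^ 2 / 2) ∂μ < ∞ := by
  have h := (hu2.sub (memLp_const z)).integrable_norm_pow (by norm_num)
  simpa using (h.div_const 2).lintegral_lt_top

theorem memLp_id_restrict (hY2 : ∫⁻ y in Y, ENNReal.ofReal (‖y‖ ^ 2) < ∞) :
    MemLp id 2 (volume.restrict Y) := by
  rw [memLp_two_iff_integrable_sq_norm (by fun_prop)]
  exact ⟨by fun_prop, (hasFiniteIntegral_iff_ofReal (.of_forall fun _ => by positivity)).2 hY2⟩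

theorem totalCost_ne_top [IsFiniteMeasure μ] (h : π ∈ plans μ Y) (hu2 : MemLp u 2 μ)
    (hY2 : ∫⁻ y in Y, ENNReal.ofReal (‖y‖ ^ 2) < ∞) :
    totalCost u π ≠ ∞ := by
  have h1 : MemLp (fun p : X × Y => u p.1) 2 π := by
    rw [← map_fst_of_mem_plans h] at hu2
    exact hu2.comp_of_map (by fun_prop)
  have h2 : MemLp (fun p : X × Y => (p.2 : EuclideanSpace ℝ (Fin n))) 2 π := by
    have := memLp_id_restrict hY2
    rw [← map_snd_of_mem_plans h] at this
    exact this.comp_of_map (by fun_prop)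
  have h3 := (h1.sub h2).integrable_norm_pow (by norm_num)
  exact ((h3.div_const 2).lintegral_lt_top).ne

end Plans

/-! ### Sufficiency by Fenchel–Young duality -/

section Sufficiency

variable {E : Type*} [NormedAddCommGroup E] [InnerProductSpace ℝ E]

/-- The excess of `ψ` over the affine function with slope `z₀` and value `ψ y₀` at `y₀`. -/
noncomputable def excess (ψ : E → EReal) (z₀ y₀ y : E) : ℝ≥0∞ :=
  (ψ y + ((-((ψ y₀).toReal + inner ℝ z₀ (y - y₀)) : ℝ) : EReal)).toENNReal

/-- A nonnegative version of the convex conjugate of `ψ`, dual to `excess ψ z₀ y₀`. -/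
noncomputable def conjExcess (ψ : E → EReal) (z₀ y₀ z : E) : ℝ≥0∞ :=
  ⨆ y, ENNReal.ofReal (inner ℝ (z - z₀) (y - y₀)) - excess ψ z₀ y₀ y

theorem LowerSemicontinuous.measurable_excess [MeasurableSpace E] [BorelSpace E]
    [SecondCountableTopology E] {ψ : E → EReal} (hψ : LowerSemicontinuous ψ) (z₀ y₀ : E) :
    Measurable (excess ψ z₀ y₀) := by
  have h1 : Measurable ψ := hψ.measurable
  unfold excess
  exact (h1.add (Measurable.coe_real_ereal (by fun_prop))).ereal_toENNReal

theorem measurable_conjExcess [MeasurableSpace E] [BorelSpace E] (ψ : E → EReal) (z₀ y₀ : E) :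
    Measurable (conjExcess ψ z₀ y₀) := by
  refine LowerSemicontinuous.measurable (lowerSemicontinuous_iSup fun y => ?_)
  refine Continuous.lowerSemicontinuous ((ENNReal.continuous_sub_right _).comp ?_)
  exact ENNReal.continuous_ofReal.comp (by fun_prop)

theorem IsProperFun.exists_eq_coe {ψ : E → EReal} (hψ : IsProperFun ψ) {z y : E}
    (h : z ∈ subdifferential ψ y) : ∃ r : ℝ, ψ y = r := by
  obtain ⟨w, hw⟩ := hψ.1
  refine ⟨(ψ y).toReal, (EReal.coe_toReal (fun hy => hw ?_) (hψ.2 y)).symm⟩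
  have := h w
  rwa [hy, EReal.top_add_coe, top_le_iff] at this

theorem ofReal_inner_le_excess_add (ψ : E → EReal) (z₀ y₀ z y : E) :
    ENNReal.ofReal (inner ℝ (z - z₀) (y - y₀)) ≤ excess ψ z₀ y₀ y + conjExcess ψ z₀ y₀ z := by
  rw [← tsub_le_iff_left]
  exact le_iSup (fun y => ENNReal.ofReal (inner ℝ (z - z₀) (y - y₀)) - excess ψ z₀ y₀ y) y

/-- The equality case of Fenchel–Young. The subgradient inequality at y₀ makes the excess
nonnegative, so truncation at 0 loses nothing. -/
theorem excess_add_conjExcess_le {ψ : E → EReal} (hψ : IsProperFun ψ) {z₀ y₀ z y : E}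
    (h₀ : z₀ ∈ subdifferential ψ y₀) (h : z ∈ subdifferential ψ y) :
    0 ≤ inner ℝ (z - z₀) (y - y₀) ∧ excess ψ z₀ y₀ y + conjExcess ψ z₀ y₀ z ≤
      ENNReal.ofReal (inner ℝ (z - z₀) (y - y₀)) := by
  obtain ⟨r₀, hr₀⟩ := hψ.exists_eq_coe h₀
  obtain ⟨r, hr⟩ := hψ.exists_eq_coe h
  have hA : excess ψ z₀ y₀ y = ENNReal.ofReal (r - (r₀ + inner ℝ z₀ (y - y₀))) := by
    simp only [excess, hr, hr₀, EReal.toReal_coe, ← EReal.coe_add, EReal.toENNReal_of_ne_top,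
      ne_eq, EReal.coe_ne_top, not_false_eq_true, sub_eq_add_neg]
  have h1 := h₀ y
  have h2 := h y₀
  rw [hr₀, hr, ← EReal.coe_add, EReal.coe_le_coe_iff] at h1 h2
  have h3 : inner ℝ z (y₀ - y) = - inner ℝ z (y - y₀) := by rw [← inner_neg_right, neg_sub]
  have h4 : inner ℝ (z - z₀) (y - y₀) = inner ℝ z (y - y₀) - inner ℝ z₀ (y - y₀) :=
    inner_sub_left _ _ _
  refine ⟨by linarith, ?_⟩
  have hB : conjExcess ψ z₀ y₀ z ≤ ENNReal.ofReal (inner ℝ (z - z₀) (y - y₀) -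
      (r - (r₀ + inner ℝ z₀ (y - y₀)))) := by
    refine iSup_le fun w => ?_
    have hw := h w
    rcases eq_or_ne (ψ w) ⊤ with ht | ht
    · have : excess ψ z₀ y₀ w = ∞ := by
        rw [excess, ht, EReal.top_add_coe, EReal.toENNReal_top]
      simp [this]
    · lift ψ w to ℝ using ⟨ht, hψ.2 w⟩ with s hs
      have hAw : excess ψ z₀ y₀ w = ENNReal.ofReal (s - (r₀ + inner ℝ z₀ (w - y₀))) := by
        simp only [excess, ← hs, hr₀, EReal.toReal_coe, ← EReal.coe_add,
          EReal.toENNReal_of_ne_top, ne_eq, EReal.coe_ne_top, not_false_eq_true, sub_eq_add_neg]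
      have h5 := h₀ w
      rw [hr₀, ← hs, ← EReal.coe_add, EReal.coe_le_coe_iff] at h5
      rw [hr, ← EReal.coe_add, EReal.coe_le_coe_iff] at hw
      rw [hAw, ← ENNReal.ofReal_sub _ (by linarith)]
      refine ENNReal.ofReal_le_ofReal ?_
      simp only [inner_sub_left, inner_sub_right] at *
      linarith
  rw [hA]
  refine (add_le_add_right hB _).trans ?_
  rw [← ENNReal.ofReal_add (by linarith) (by linarith)]
  exact ENNReal.ofReal_le_ofReal (by linarith)

/-- Centring the squares at y₀ and z₀ leaves only the product (z - z₀)·(y - y₀), which is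
nonnegative on the graph of ∂ψ. -/
theorem half_norm_sub_sq_add_inner (z₀ y₀ z y : E) :
    ‖z - y‖ ^ 2 / 2 + inner ℝ (z - z₀) (y - y₀) + ‖z₀ - y₀‖ ^ 2 / 2 =
      ‖z - y₀‖ ^ 2 / 2 + ‖y - z₀‖ ^ 2 / 2 := by
  simp only [norm_sub_sq_real, inner_sub_left, inner_sub_right, real_inner_comm]
  ring

variable {X : Type*} [MeasurableSpace X] {n : ℕ} {Y : Set (EuclideanSpace ℝ (Fin n))}
  {μ : Measure X} {π : Measure (X × Y)} {u : X → EuclideanSpace ℝ (Fin n)}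

theorem isMinOn_totalCost_of_subdifferential [IsFiniteMeasure μ] (hu : Measurable u)
    (hu2 : MemLp u 2 μ) (hY : volume Y ≠ ∞) (hY2 : ∫⁻ y in Y, ENNReal.ofReal (‖y‖ ^ 2) < ∞)
    {ψ : EuclideanSpace ℝ (Fin n) → EReal} (hπ : π ∈ plans μ Y) (hψ : IsProperFun ψ)
    (hlsc : LowerSemicontinuous ψ) (hsub : ∀ᵐ p ∂π, u p.1 ∈ subdifferential ψ p.2) :
    IsMinOn (totalCost u) (plans μ Y) π := by
  rcases eq_or_ne π 0 with rfl | h0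
  · intro γ _
    simp [totalCost]
  have : (ae π).NeBot := ae_neBot.2 h0
  obtain ⟨⟨x₀, y₀⟩, h₀⟩ := hsub.exists
  have : IsFiniteMeasure (volume.restrict Y) := isFiniteMeasure_restrict.2 hY
  set z₀ := u x₀
  set A := excess ψ z₀ y₀
  set B := conjExcess ψ z₀ y₀
  have hA : Measurable A := LowerSemicontinuous.measurable_excess hlsc _ _
  have hB : Measurable B := measurable_conjExcess _ _ _
  set a : ℝ≥0∞ := ∫⁻ y in Y, A y
  set b : ℝ≥0∞ := ∫⁻ x, B (u x) ∂μ
  set K : ℝ≥0∞ := ENNReal.ofReal (‖z₀ - (y₀ : EuclideanSpace ℝ (Fin n))‖ ^ 2 / 2)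
  set f : EuclideanSpace ℝ (Fin n) → ℝ≥0∞ :=
    fun z => ENNReal.ofReal (‖z - (y₀ : EuclideanSpace ℝ (Fin n))‖ ^ 2 / 2)
  set g : EuclideanSpace ℝ (Fin n) → ℝ≥0∞ := fun y => ENNReal.ofReal (‖y - z₀‖ ^ 2 / 2)
  have hf : Measurable f := by fun_prop
  have hg : Measurable g := by fun_prop
  set S : ℝ≥0∞ := ∫⁻ x, f (u x) ∂μ + ∫⁻ y in Y, g y
  have hS : S ≠ ∞ := ENNReal.add_ne_top.2 ⟨(lintegral_norm_sub_sq_lt_top hu2 _).ne,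
    (lintegral_norm_sub_sq_lt_top (memLp_id_restrict hY2) _).ne⟩
  have hleft : ∀ γ ∈ plans μ Y,
      ∫⁻ p, (cost u p + (A p.2 + B (u p.1)) + K) ∂γ = totalCost u γ + (a + b + K * μ univ) := by
    intro γ hγ
    have h1 : γ univ = μ univ := by rw [← hγ.1 univ .univ, univ_prod_univ]
    rw [lintegral_add_right _ measurable_const, lintegral_add_left (measurable_cost hu),
      lintegral_add_left (by fun_prop), lintegral_snd_of_mem_plans hγ hA,
      lintegral_fst_of_mem_plans hγ (f := fun x => B (u x)) (by fun_prop), lintegral_const, h1,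
      totalCost, add_assoc]
  have hright : ∀ γ ∈ plans μ Y, ∫⁻ p, (f (u p.1) + g p.2) ∂γ = S := by
    intro γ hγ
    rw [lintegral_add_left (by fun_prop), lintegral_snd_of_mem_plans hγ hg,
      lintegral_fst_of_mem_plans hγ (f := fun x => f (u x)) (by fun_prop)]
  have hπS : totalCost u π + (a + b + K * μ univ) ≤ S := by
    rw [← hleft π hπ, ← hright π hπ]
    refine lintegral_mono_ae ?_
    filter_upwards [hsub] with p hp
    obtain ⟨hpos, hle⟩ := excess_add_conjExcess_le hψ h₀ hp
    refine (add_le_add_left (add_le_add_right hle _) _).trans ?_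
    rw [cost, ← ENNReal.ofReal_add (by positivity) hpos,
      ← ENNReal.ofReal_add (by positivity) (by positivity), half_norm_sub_sq_add_inner,
      ENNReal.ofReal_add (by positivity) (by positivity)]
  -- The inequality for π itself supplies the integrability of the dual pair, so it can be
  -- cancelled.
  have hR : a + b + K * μ univ ≠ ∞ := ne_top_of_le_ne_top hS (le_add_self.trans hπS)
  intro γ hγ
  refine (ENNReal.add_le_add_iff_right hR).1 (hπS.trans ?_)
  rw [← hleft γ hγ, ← hright γ hγ]
  refine lintegral_mono fun p => ?_
  refine le_trans ?_
    (add_le_add_left (add_le_add_right (ofReal_inner_le_excess_add ψ z₀ y₀ _ _) _) _)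
  dsimp only [f, g]
  rw [← ENNReal.ofReal_add (by positivity) (by positivity), ← half_norm_sub_sq_add_inner]
  exact ENNReal.ofReal_add_le.trans (add_le_add_left ENNReal.ofReal_add_le _)

end Sufficiency

/-! ### Necessity by re-pairing mass -/

section Necessity

variable {X : Type*} [MeasurableSpace X] {n : ℕ} {Y : Set (EuclideanSpace ℝ (Fin n))}
  {μ : Measure X} {π : Measure (X × Y)} {u : X → EuclideanSpace ℝ (Fin n)}

/-- Replacing finitely many normalised pieces `ν i` of an optimal plan by the products of the
first marginal of `ν i` with the second marginal of `ν (σ i)` does not lower the cost. -/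
theorem sum_lintegral_cost_le_of_isMinOn [IsFiniteMeasure π]
    (hπ : π ∈ plans μ Y) (hmin : IsMinOn (totalCost u) (plans μ Y) π)
    (hfin : totalCost u π ≠ ∞) {ι : Type*} [Fintype ι] [Nonempty ι] (σ : Equiv.Perm ι)
    (W : ι → Set (X × Y)) (hW : ∀ i, π (W i) ≠ 0) :
    ∑ i, ∫⁻ p, cost u p ∂((π (W i))⁻¹ • π.restrict (W i)) ≤
      ∑ i, ∫⁻ p, cost u p ∂((((π (W i))⁻¹ • π.restrict (W i)).map Prod.fst).prod
        (((π (W (σ i)))⁻¹ • π.restrict (W (σ i))).map Prod.snd)) := by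
  set ν : ι → Measure (X × Y) := fun i => (π (W i))⁻¹ • π.restrict (W i) with hν
  have hprob : ∀ i, IsProbabilityMeasure (ν i) := fun i => by
    refine ⟨?_⟩
    simp only [hν, Measure.smul_apply, Measure.restrict_apply_univ, smul_eq_mul]
    exact ENNReal.inv_mul_cancel (hW i) (measure_ne_top _ _)
  have hprob1 : ∀ i, IsProbabilityMeasure ((ν i).map Prod.fst) := fun i =>
    Measure.isProbabilityMeasure_map (by fun_prop)
  have hprob2 : ∀ i, IsProbabilityMeasure ((ν i).map Prod.snd) := fun i =>
    Measure.isProbabilityMeasure_map (by fun_prop)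
  -- The pieces sum to at most s • π, even when the sets `W i` overlap; dividing by s lets them be
  -- subtracted from π.
  set s : ℝ≥0∞ := ∑ i, (π (W i))⁻¹ with hs
  have hs_top : s ≠ ∞ := by simp [hs, ENNReal.sum_eq_top, hW]
  have hs0 : s ≠ 0 := by
    simp [hs, Finset.sum_eq_zero_iff, measure_ne_top]
  set old : Measure (X × Y) := s⁻¹ • ∑ i, ν i with hold
  set new : Measure (X × Y) :=
    s⁻¹ • ∑ i, ((ν i).map Prod.fst).prod ((ν (σ i)).map Prod.snd) with hnew
  have hle : old ≤ π := by
    have h1 : ∑ i, ν i ≤ s • π := by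
      rw [hs, Finset.sum_smul]
      refine Finset.sum_le_sum fun i _ => ?_
      refine Measure.le_iff'.2 fun t => ?_
      simp only [hν, Measure.smul_apply, smul_eq_mul]
      gcongr
      exact Measure.restrict_le_self
    refine Measure.le_iff'.2 fun t => ?_
    have h2 := Measure.le_iff'.1 h1 t
    rw [hold, Measure.smul_apply, smul_eq_mul]
    rw [Measure.smul_apply, smul_eq_mul] at h2
    calc s⁻¹ * (∑ i, ν i) t ≤ s⁻¹ * (s * π t) := by gcongr
      _ = π t := by rw [← mul_assoc, ENNReal.inv_mul_cancel hs0 hs_top, one_mul]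
  have : IsFiniteMeasure old := isFiniteMeasure_of_le π hle
  have hadd : π - old + old = π := Measure.sub_add_cancel_of_le hle
  have hplan : π - old + new ∈ plans μ Y := by
    refine mem_plans_of_map_eq hπ ?_ ?_
    · rw [Measure.map_add _ _ measurable_fst]
      have h : new.map Prod.fst = old.map Prod.fst := by
        rw [hnew, hold, Measure.map_smul, Measure.map_smul,
          Measure.map_finset_sum (by fun_prop), Measure.map_finset_sum (by fun_prop)]
        congr 1
        refine Finset.sum_congr rfl fun i _ => ?_
        rw [Measure.map_fst_prod, measure_univ, one_smul]
      rw [h, ← Measure.map_add _ _ measurable_fst, hadd]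
    · rw [Measure.map_add _ _ measurable_snd]
      have h : new.map Prod.snd = old.map Prod.snd := by
        rw [hnew, hold, Measure.map_smul, Measure.map_smul,
          Measure.map_finset_sum (by fun_prop), Measure.map_finset_sum (by fun_prop)]
        congr 1
        rw [← Equiv.sum_comp σ fun i => (ν i).map Prod.snd]
        refine Finset.sum_congr rfl fun i _ => ?_
        rw [Measure.map_snd_prod, measure_univ, one_smul]
      rw [h, ← Measure.map_add _ _ measurable_snd, hadd]
  have hcost : totalCost u π ≤ totalCost u (π - old + new) := hmin hplan
  have hrest : totalCost u (π - old) ≠ ∞ :=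
    ne_top_of_le_ne_top hfin (lintegral_mono' Measure.sub_le le_rfl)
  rw [← hadd] at hcost
  simp only [totalCost, lintegral_add_measure] at hcost hrest
  rw [hadd] at hcost
  rw [ENNReal.add_le_add_iff_left hrest, hold, hnew, lintegral_smul_measure,
    lintegral_smul_measure, lintegral_finsetSum_measure, lintegral_finsetSum_measure] at hcost
  exact (ENNReal.mul_le_mul_iff_right (ENNReal.inv_ne_zero.2 hs_top)
    (ENNReal.inv_ne_top.2 hs0)).1 hcost

/-- The image under `(u, id)` of a plan. -/
noncomputable def imagePlan (u : X → EuclideanSpace ℝ (Fin n)) (π : Measure (X × Y)) :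
    Measure (EuclideanSpace ℝ (Fin n) × EuclideanSpace ℝ (Fin n)) :=
  π.map fun p => (u p.1, (p.2 : EuclideanSpace ℝ (Fin n)))

theorem sum_half_norm_sub_sq_le_of_isMinOn (hu : Measurable u) [IsFiniteMeasure π]
    (hπ : π ∈ plans μ Y) (hmin : IsMinOn (totalCost u) (plans μ Y) π)
    (hfin : totalCost u π ≠ ∞) {ι : Type*} [Fintype ι] [Nonempty ι] (σ : Equiv.Perm ι)
    (q : ι → EuclideanSpace ℝ (Fin n) × EuclideanSpace ℝ (Fin n))
    (hq : ∀ i, q i ∈ (imagePlan u π).support) :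
    ∑ i, ‖(q i).1 - (q i).2‖ ^ 2 / 2 ≤ ∑ i, ‖(q i).1 - (q (σ i)).2‖ ^ 2 / 2 := by
  by_contra! hlt
  set N : ℝ := (Fintype.card ι : ℝ) with hN
  have hN0 : 0 ≤ N := by positivity
  set G : ℝ := ∑ i, ‖(q i).1 - (q i).2‖ ^ 2 / 2 - ∑ i, ‖(q i).1 - (q (σ i)).2‖ ^ 2 / 2 with hG
  have hG0 : 0 < G := sub_pos.2 hlt
  -- Each of the 2N cost terms errs by at most δ; the extra 1 keeps the total strictly below the gap
  -- G.
  set δ : ℝ := G / (2 * N + 1) with hδ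
  have hδ0 : 0 < δ := by positivity
  have hδG : 2 * N * δ < G := by
    have : (2 * N + 1) * δ = G := by rw [hδ]; field_simp
    linarith
  let c : EuclideanSpace ℝ (Fin n) × EuclideanSpace ℝ (Fin n) → ℝ :=
    fun p => ‖p.1 - p.2‖ ^ 2 / 2
  have hc : Continuous c := by fun_prop
  have hball : ∀ a, ∀ᶠ r in nhdsWithin (0 : ℝ) (Ioi 0), ∀ b ∈ Metric.ball a r,
      |c b - c a| < δ := by
    intro a
    obtain ⟨r, hr, h⟩ := Metric.continuous_iff.1 hc a δ hδ0
    filter_upwards [Ioo_mem_nhdsGT hr] with r' hr' b hb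
    exact h b ((Metric.mem_ball.1 hb).trans hr'.2)
  obtain ⟨r, ⟨h1, h2⟩, hr⟩ := (((Filter.eventually_all.2 fun i => hball (q i)).and
    (Filter.eventually_all.2 fun i => hball ((q i).1, (q (σ i)).2))).and
    self_mem_nhdsWithin).exists
  have hr : 0 < r := hr
  let W : ι → Set (X × Y) := fun i =>
    {p | (u p.1, (p.2 : EuclideanSpace ℝ (Fin n))) ∈ Metric.ball (q i) r}
  have hmeas : Measurable fun p : X × Y => (u p.1, (p.2 : EuclideanSpace ℝ (Fin n))) := by
    fun_prop
  have hWm : ∀ i, MeasurableSet (W i) := fun i => hmeas Metric.isOpen_ball.measurableSet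
  have hW : ∀ i, π (W i) ≠ 0 := by
    intro i
    have := (Measure.mem_support_iff_forall _).1 (hq i) _ (Metric.ball_mem_nhds _ hr)
    rw [imagePlan, Measure.map_apply hmeas Metric.isOpen_ball.measurableSet] at this
    exact this.ne'
  have key := sum_lintegral_cost_le_of_isMinOn hπ hmin hfin σ W hW
  set ν : ι → Measure (X × Y) := fun i => (π (W i))⁻¹ • π.restrict (W i) with hν
  have hprob : ∀ i, IsProbabilityMeasure (ν i) := fun i => by
    refine ⟨?_⟩
    simp only [hν, Measure.smul_apply, Measure.restrict_apply_univ, smul_eq_mul]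
    exact ENNReal.inv_mul_cancel (hW i) (measure_ne_top _ _)
  have hprob1 : ∀ i, IsProbabilityMeasure ((ν i).map Prod.fst) := fun i =>
    Measure.isProbabilityMeasure_map (by fun_prop)
  have hprob2 : ∀ i, IsProbabilityMeasure ((ν i).map Prod.snd) := fun i =>
    Measure.isProbabilityMeasure_map (by fun_prop)
  have hνW : ∀ i, ∀ᵐ p ∂ν i, p ∈ W i := fun i =>
    Measure.ae_smul_measure (ae_restrict_mem (hWm i)) _
  have hWb : ∀ i, ∀ p ∈ W i, u p.1 ∈ Metric.ball (q i).1 r ∧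
      (p.2 : EuclideanSpace ℝ (Fin n)) ∈ Metric.ball (q i).2 r := by
    intro i p hp
    have : dist (u p.1, (p.2 : EuclideanSpace ℝ (Fin n))) (q i) < r := hp
    rwa [Prod.dist_eq, max_lt_iff] at this
  have hfst : ∀ i, ∀ᵐ x ∂(ν i).map Prod.fst, u x ∈ Metric.ball (q i).1 r := by
    intro i
    rw [ae_map_iff (by fun_prop) (hu Metric.isOpen_ball.measurableSet)]
    filter_upwards [hνW i] with p hp
    exact (hWb i p hp).1
  have hsnd : ∀ i, ∀ᵐ y : Y ∂(ν i).map Prod.snd,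
      (y : EuclideanSpace ℝ (Fin n)) ∈ Metric.ball (q i).2 r := by
    intro i
    have hB : MeasurableSet {y : Y | (y : EuclideanSpace ℝ (Fin n)) ∈ Metric.ball (q i).2 r} :=
      measurable_subtype_coe Metric.isOpen_ball.measurableSet
    rw [ae_map_iff measurable_snd.aemeasurable hB]
    filter_upwards [hνW i] with p hp
    exact (hWb i p hp).2
  have hlow : ∀ i, ENNReal.ofReal (c (q i) - δ) ≤ ∫⁻ p, cost u p ∂ν i := by
    intro i
    calc ENNReal.ofReal (c (q i) - δ) = ∫⁻ _, ENNReal.ofReal (c (q i) - δ) ∂ν i := by simp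
      _ ≤ _ := lintegral_mono_ae ?_
    filter_upwards [hνW i] with p hp
    refine ENNReal.ofReal_le_ofReal ?_
    have := (abs_lt.1 (h1 i _ hp)).1
    change _ ≤ c (u p.1, (p.2 : EuclideanSpace ℝ (Fin n)))
    linarith
  have hup : ∀ i, ∫⁻ p, cost u p ∂(((ν i).map Prod.fst).prod ((ν (σ i)).map Prod.snd)) ≤
      ENNReal.ofReal (c ((q i).1, (q (σ i)).2) + δ) := by
    intro i
    calc _ ≤ ∫⁻ _, ENNReal.ofReal (c ((q i).1, (q (σ i)).2) + δ)
          ∂(((ν i).map Prod.fst).prod ((ν (σ i)).map Prod.snd)) := lintegral_mono_ae ?_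
      _ = _ := by simp
    filter_upwards [Measure.quasiMeasurePreserving_fst.ae (hfst i),
      Measure.quasiMeasurePreserving_snd.ae (hsnd (σ i))] with p hp1 hp2
    refine ENNReal.ofReal_le_ofReal ?_
    have := (abs_lt.1 (h2 i (u p.1, (p.2 : EuclideanSpace ℝ (Fin n))) (by
      rw [← ball_prod_same]; exact ⟨hp1, hp2⟩))).2
    change c (u p.1, (p.2 : EuclideanSpace ℝ (Fin n))) ≤ _
    linarith
  have hsum : ENNReal.ofReal (∑ i, (c (q i) - δ)) ≤
      ENNReal.ofReal (∑ i, (c ((q i).1, (q (σ i)).2) + δ)) := by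
    rw [ENNReal.ofReal_sum_of_nonneg (f := fun i => c ((q i).1, (q (σ i)).2) + δ)
      fun i _ => by positivity]
    calc _ ≤ ∑ i, ENNReal.ofReal (c (q i) - δ) :=
          Finset.le_sum_of_subadditive _ ENNReal.ofReal_zero.le
            (fun _ _ => ENNReal.ofReal_add_le) _ _
      _ ≤ _ := Finset.sum_le_sum fun i _ => hlow i
      _ ≤ _ := key
      _ ≤ _ := Finset.sum_le_sum fun i _ => hup i
  rw [ENNReal.ofReal_le_ofReal_iff (Finset.sum_nonneg fun i _ => by positivity),
    Finset.sum_sub_distrib, Finset.sum_add_distrib, Finset.sum_const, Finset.card_univ,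
    nsmul_eq_mul, ← hN] at hsum
  simp only [c] at hsum
  linarith

theorem isCyclicallyMonotone_support_imagePlan (hu : Measurable u) [IsFiniteMeasure π]
    (hπ : π ∈ plans μ Y) (hmin : IsMinOn (totalCost u) (plans μ Y) π)
    (hfin : totalCost u π ≠ ∞) : IsCyclicallyMonotone (imagePlan u π).support := by
  intro m q hq
  have h := sum_half_norm_sub_sq_le_of_isMinOn hu hπ hmin hfin (finRotate (m + 1)) q hq
  -- The squares |y|² are merely permuted, so only the inner products survive.
  have h1 := Equiv.sum_comp (finRotate (m + 1)) fun i => ‖(q i).2‖ ^ 2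
  simp only [norm_sub_sq_real, ← Finset.sum_div, Finset.sum_add_distrib,
    Finset.sum_sub_distrib, ← Finset.mul_sum] at h
  linarith

end Necessity

end PolarInclusion

theorem theorem3 {X : Type*} [TopologicalSpace X] [PolishSpace X] [MeasurableSpace X]
    (μ : Measure X) (hμ : PolarInclusion.IsMeasureInterval μ)
    (n : ℕ) (Y : Set (EuclideanSpace ℝ (Fin n))) (hY : NullMeasurableSet Y volume)
    (hμY : μ univ = volume Y)
    (hY2 : ∫⁻ y in Y, ENNReal.ofReal (‖y‖ ^ 2) < ∞)
    (u : X → EuclideanSpace ℝ (Fin n)) (hu : MemLp u 2 μ) :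
    (∀ (π : Measure (X × Y)) (ψ : EuclideanSpace ℝ (Fin n) → EReal),
      π ∈ PolarInclusion.plans μ Y →
      PolarInclusion.IsProperFun ψ → PolarInclusion.IsConvexFun ψ → LowerSemicontinuous ψ →
      (∀ᵐ p ∂π, u p.1 ∈ PolarInclusion.subdifferential ψ (p.2 : EuclideanSpace ℝ (Fin n))) →
      IsMinOn (PolarInclusion.totalCost u) (PolarInclusion.plans μ Y) π) ∧
    (LowerSemicontinuous (PolarInclusion.cost u : X × Y → ℝ≥0∞) →
      ∀ π : Measure (X × Y), π ∈ PolarInclusion.plans μ Y →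
      IsMinOn (PolarInclusion.totalCost u) (PolarInclusion.plans μ Y) π →
      ∃ ψ : EuclideanSpace ℝ (Fin n) → EReal,
        PolarInclusion.IsProperFun ψ ∧ PolarInclusion.IsConvexFun ψ ∧ LowerSemicontinuous ψ ∧
        ∀ᵐ p ∂π, u p.1 ∈ PolarInclusion.subdifferential ψ
          (p.2 : EuclideanSpace ℝ (Fin n))) := by
  have := hμ.isFiniteMeasure
  have := hμ.isComplete
  -- Completeness of μ upgrades a.e. measurability of u to measurability.
  have hum : Measurable u :=
    hu.aestronglyMeasurable.aemeasurable.nullMeasurable.measurable_of_complete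
  refine ⟨fun π ψ hπ hψ _ hlsc hsub =>
    PolarInclusion.isMinOn_totalCost_of_subdifferential hum hu (hμY ▸ measure_ne_top μ univ) hY2
      hπ hψ hlsc hsub, fun _ π hπ hmin => ?_⟩
  have : IsFiniteMeasure π := by
    refine ⟨?_⟩
    rw [← univ_prod_univ, hπ.1 univ .univ]
    exact measure_lt_top μ univ
  obtain ⟨ψ, hproper, hconvex, hlsc, hsub⟩ :=
    (PolarInclusion.isCyclicallyMonotone_support_imagePlan hum hπ hmin
      (PolarInclusion.totalCost_ne_top hπ hu hY2)).exists_subdifferential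
  refine ⟨ψ, hproper, hconvex, hlsc, ?_⟩
  have hmeas : Measurable fun p : X × Y => (u p.1, (p.2 : EuclideanSpace ℝ (Fin n))) := by
    fun_prop
  filter_upwards [ae_of_ae_map hmeas.aemeasurable
    (Measure.support_mem_ae (μ := PolarInclusion.imagePlan u π))] with p hp
  exact hsub _ hp
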